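/- Let $K$ be a field and let $A$ be a symmetric $K$-algebra, that is, a finite-dimensional (associative, unital) $K$-algebra that admits a nondegenerate symmetric $K$-bilinear form $B : A \times A \to K$ with $B(ab,c) = B(a,bc)$ for all $a,b,c \in A$. For a finitely generated right $A$-module $X$, let $\Omega X$ denote the kernel of a projective cover $P \to X$; it is finitely generated and unique up to isomorphism. Let $M$ be a finitely generated right $A$-module with $\Omega^4 M \cong M$. If $\operatorname{Ext}_A^1(M,M) \neq 0$, then $\operatorname{Ext}_A^i(M,M) \neq 0$ for all integers $i \geq 1$. -/

import Mathlib

universe u v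

/-- A `K`-algebra `A` is symmetric if it is finite dimensional over the field `K` and carries a
nondegenerate symmetric `K`-bilinear form that is associative, `B (ab, c) = B (a, bc)`.
Equivalently, `A` and `D A = Hom_K(A, K)` are isomorphic as `A`-`A`-bimodules. -/
structure IsSymmetricAlg (K : Type u) (A : Type v) [Field K] [Ring A] [Algebra K A] :
    Prop where
  finite : Module.Finite K A
  exists_form : ∃ B : LinearMap.BilinForm K A,
    B.Nondegenerate ∧ B.IsSymm ∧ ∀ a b c : A, B (a * b) c = B a (b * c)

/-- A linear map `f : P → M` is a projective cover if `P` is projective, `f` is surjective, and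
the kernel of `f` is superfluous: a submodule `U` with `ker f + U = P` is all of `P`. -/
structure IsProjectiveCover {R : Type v} [Ring R] {P M : Type v} [AddCommGroup P] [Module R P]
    [AddCommGroup M] [Module R M] (f : P →ₗ[R] M) : Prop where
  projective : Module.Projective R P
  surjective : Function.Surjective f
  superfluous : ∀ U : Submodule R P, LinearMap.ker f ⊔ U = ⊤ → U = ⊤

/-- `IsSyzygy R n M N` says that `Ω^n M ≅ N`, where `Ω M` is the kernel of a projective cover of
`M` (unique up to isomorphism), `Ω^0 M = M` and `Ω^(n+1) M = Ω^n (Ω M)`. -/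
def IsSyzygy (R : Type v) [Ring R] : ℕ → ModuleCat.{v} R → ModuleCat.{v} R → Prop
  | 0, M, N => Nonempty (M ≅ N)
  | n + 1, M, N => ∃ (P : ModuleCat.{v} R) (f : P →ₗ[R] M),
      IsProjectiveCover f ∧ IsSyzygy R n (ModuleCat.of R (LinearMap.ker f)) N

/-! Over a symmetric algebra the trace pairs `Hom(N, P)` perfectly with `Hom(P, N)` for finitely
generated `N` and `P`, `P` projective. Dualizing along a projective resolution gives the vanishing
half of the Auslander–Reiten formula `D Ext¹(X, N) ≅ \underline{Hom}(N, Ω²X)`: if `Ext¹(X, N) = 0`,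
every map `N → Ω²X` lifts to the projective covering `Ω²X` (`exists_lift_of_subsingleton_ext_one`).

Let `Ω⁴M ≅ M` and use `Extⁱ⁺¹(M, M) = Ext¹(ΩⁱM, M)`. If `Ext² = 0`, all maps `M → Ω³M` lift to `P₃`,
forcing `Ext¹(M, Ω⁴M) = Ext¹(M, M) = 0`. If `Ext³ = 0`, the isomorphism `M → Ω⁴M` lifts to a
projective; if `Ext⁴ = 0`, the isomorphism `Ω⁴M → M` extends to `P₃`. In the last two cases `M` is
projective, again contradicting `Ext¹(M, M) ≠ 0`. Periodicity gives the higher degrees. -/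

/-! ### Symmetrizing forms and self-injectivity. -/

/-- A linear form on a finite-dimensional algebra `R` which makes `R` a symmetric algebra. -/
structure IsSymmetrizingForm {K : Type*} {R : Type*} [Field K] [Ring R] [Algebra K R]
    (lam : R →ₗ[K] K) : Prop where
  comm : ∀ a b : R, lam (a * b) = lam (b * a)
  nondegenerate : ∀ a : R, a ≠ 0 → ∃ b : R, lam (a * b) ≠ 0

theorem IsSymmetricAlg.exists_isSymmetrizingForm_op {K : Type*} {A : Type*} [Field K] [Ring A]
    [Algebra K A] (hA : IsSymmetricAlg K A) :
    ∃ lam : Aᵐᵒᵖ →ₗ[K] K, IsSymmetrizingForm lam := by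
  obtain ⟨B, hB, hs, hassoc⟩ := hA.exists_form
  have key : ∀ a b : A, B 1 (a * b) = B a b := fun a b ↦ by
    rw [← hassoc, one_mul]
  refine ⟨(B 1) ∘ₗ (MulOpposite.opLinearEquiv K).symm.toLinearMap, ⟨fun a b ↦ ?_, fun a ha ↦ ?_⟩⟩
  · simp only [LinearMap.comp_apply, LinearEquiv.coe_coe, MulOpposite.coe_opLinearEquiv_symm,
      MulOpposite.unop_mul, key]
    exact hs.eq _ _
  · by_contra! h
    apply ha
    apply MulOpposite.unop_injective
    refine hB.2 _ fun b ↦ ?_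
    have := h (MulOpposite.op b)
    simpa only [LinearMap.comp_apply, LinearEquiv.coe_coe, MulOpposite.coe_opLinearEquiv_symm,
      MulOpposite.unop_mul, key, MulOpposite.unop_op] using this

namespace IsSymmetrizingForm

variable {K R : Type*} [Field K] [Ring R] [Algebra K R] {lam : R →ₗ[K] K}

/-- Over a symmetric algebra, every linear form on a module is induced by a unique
`R`-linear map to `R`. -/
theorem exists_lift (h : IsSymmetrizingForm lam) [Module.Finite K R]
    {N : Type*} [AddCommGroup N] [Module R N] [Module K N] [IsScalarTower K R N]
    (xi : N →ₗ[K] K) : ∃ g : N →ₗ[R] R, ∀ x, lam (g x) = xi x := by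
  let D : R →ₗ[K] Module.Dual K R :=
    LinearMap.mk₂ K (fun c a ↦ lam (a * c)) (by simp [mul_add]) (by simp) (by simp [add_mul])
      (by simp)
  have hD : Function.Injective D := by
    rw [injective_iff_map_eq_zero]
    intro c hc
    by_contra hne
    obtain ⟨b, hb⟩ := h.nondegenerate c hne
    exact hb (by rw [h.comm]; exact LinearMap.congr_fun hc b)
  have hsurj : Function.Surjective D :=
    (LinearMap.injective_iff_surjective_of_finrank_eq_finrank
      (Subspace.dual_finrank_eq (K := K) (V := R)).symm).1 hD
  -- The value `g x` must represent the functional `a ↦ xi (a • x)`; its uniqueness makes `g`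
  -- linear.
  have hex : ∀ x : N, ∃ c : R, ∀ a, lam (a * c) = xi (a • x) := fun x ↦ by
    obtain ⟨c, hc⟩ := hsurj
      ⟨⟨fun a ↦ xi (a • x), by simp [add_smul]⟩, by simp⟩
    exact ⟨c, fun a ↦ LinearMap.congr_fun hc a⟩
  choose g hg using hex
  have inj : ∀ c d : R, (∀ a, lam (a * c) = lam (a * d)) → c = d := fun c d hcd ↦
    hD (LinearMap.ext hcd)
  refine ⟨⟨⟨g, fun x y ↦ inj _ _ fun a ↦ ?_⟩, fun r x ↦ inj _ _ fun a ↦ ?_⟩, fun x ↦ ?_⟩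
  · rw [mul_add, map_add, hg, hg, hg, smul_add, map_add]
  · rw [hg, RingHom.id_apply, smul_eq_mul, ← mul_assoc, hg, mul_smul]
  · simpa using hg x 1

theorem ext_of_forall_comp_eq (h : IsSymmetrizingForm lam)
    {N : Type*} [AddCommGroup N] [Module R N]
    {g g' : N →ₗ[R] R} (hg : ∀ x, lam (g x) = lam (g' x)) : g = g' := by
  ext x
  by_contra hne
  obtain ⟨b, hb⟩ := h.nondegenerate _ (sub_ne_zero.2 hne)
  apply hb
  have := hg (b • x)
  rw [g.map_smul, g'.map_smul, smul_eq_mul, smul_eq_mul] at this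
  rw [h.comm, mul_sub, map_sub, this, sub_self]

/-- Homomorphisms to the regular module of a symmetric algebra extend along injections. -/
theorem exists_extend_to_self (h : IsSymmetrizingForm lam) [Module.Finite K R]
    {X Y : Type*} [AddCommGroup X] [Module R X]
    [AddCommGroup Y] [Module R Y] (i : X →ₗ[R] Y) (hi : Function.Injective i) (g : X →ₗ[R] R) :
    ∃ g' : Y →ₗ[R] R, g' ∘ₗ i = g := by
  let : Module K X := Module.compHom X (algebraMap K R)
  let : Module K Y := Module.compHom Y (algebraMap K R)
  have : IsScalarTower K R X := IsScalarTower.of_algebraMap_smul fun _ _ ↦ rfl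
  have : IsScalarTower K R Y := IsScalarTower.of_algebraMap_smul fun _ _ ↦ rfl
  obtain ⟨p, hp⟩ := (i.restrictScalars K).exists_leftInverse_of_injective
    (LinearMap.ker_eq_bot.2 hi)
  obtain ⟨g', hg'⟩ := h.exists_lift (lam ∘ₗ g.restrictScalars K ∘ₗ p)
  refine ⟨g', h.ext_of_forall_comp_eq fun x ↦ ?_⟩
  have := LinearMap.congr_fun hp x
  simp only [LinearMap.comp_apply, LinearMap.restrictScalars_apply, LinearMap.id_apply] at this
  simp [hg', this]

/-- Finitely generated projective modules over a symmetric algebra are injective. -/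
theorem exists_extend (h : IsSymmetrizingForm lam) [Module.Finite K R]
    {X Y P : Type*} [AddCommGroup X] [Module R X] [AddCommGroup Y] [Module R Y]
    [AddCommGroup P] [Module R P] [Module.Finite R P] [Module.Projective R P]
    (i : X →ₗ[R] Y) (hi : Function.Injective i) (g : X →ₗ[R] P) :
    ∃ g' : Y →ₗ[R] P, g' ∘ₗ i = g := by
  obtain ⟨n, r, s, -, -, hrs⟩ := Module.Finite.exists_comp_eq_id_of_projective R P
  choose g' hg' using fun j : Fin n ↦
    h.exists_extend_to_self i hi (LinearMap.proj j ∘ₗ s ∘ₗ g)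
  refine ⟨r ∘ₗ LinearMap.pi g', ?_⟩
  have : LinearMap.pi g' ∘ₗ i = s ∘ₗ g := by
    ext x j
    exact LinearMap.congr_fun (hg' j) x
  rw [LinearMap.comp_assoc, this, ← LinearMap.comp_assoc, hrs, LinearMap.id_comp]

end IsSymmetrizingForm

/-! ### The trace pairing for finitely generated projectives. -/

section Trace

variable {K R : Type*} [Field K] [Ring R] [Algebra K R]

/-- The Hattori–Stallings trace of an endomorphism of a retract `P` of `R ^ n`, followed by
a linear form on `R`. -/
def retractTrace (lam : R →ₗ[K] K) {P : Type*} [AddCommGroup P] [Module R P] {n : ℕ}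
    (r : (Fin n → R) →ₗ[R] P) (s : P →ₗ[R] (Fin n → R)) (f : P →ₗ[R] P) : K :=
  ∑ i, lam (s (f (r (Pi.single i 1))) i)

variable {lam : R →ₗ[K] K} {P Q : Type*} [AddCommGroup P] [Module R P]
  [AddCommGroup Q] [Module R Q] {n m : ℕ}
  {r : (Fin n → R) →ₗ[R] P} {s : P →ₗ[R] (Fin n → R)}
  {r' : (Fin m → R) →ₗ[R] Q} {s' : Q →ₗ[R] (Fin m → R)}

theorem eq_sum_smul_of_retract (hrs : r ∘ₗ s = LinearMap.id) (p : P) :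
    p = ∑ i, s p i • r (Pi.single i 1) := by
  conv_lhs => rw [← LinearMap.id_apply (R := R) p, ← hrs, LinearMap.comp_apply,
    ← Finset.univ_sum_single (s p), map_sum]
  refine Finset.sum_congr rfl fun i _ ↦ ?_
  rw [← map_smul, ← Pi.single_smul, smul_eq_mul, mul_one]

/-- Expanded in dual bases, both sides become the same double sum, up to swapping factors under
`lam`. -/
theorem retractTrace_comm (h : IsSymmetrizingForm lam) (hrs : r ∘ₗ s = LinearMap.id)
    (hrs' : r' ∘ₗ s' = LinearMap.id) (f : P →ₗ[R] Q) (g : Q →ₗ[R] P) :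
    retractTrace lam r s (g ∘ₗ f) = retractTrace lam r' s' (f ∘ₗ g) := by
  have h1 : ∀ i, lam (s (g (f (r (Pi.single i 1)))) i) =
      ∑ j, lam (s' (f (r (Pi.single i 1))) j * s (g (r' (Pi.single j 1))) i) := fun i ↦ by
    conv_lhs => rw [eq_sum_smul_of_retract hrs' (f (r (Pi.single i 1)))]
    simp
  have h2 : ∀ j, lam (s' (f (g (r' (Pi.single j 1)))) j) =
      ∑ i, lam (s (g (r' (Pi.single j 1))) i * s' (f (r (Pi.single i 1))) j) := fun j ↦ by
    conv_lhs => rw [eq_sum_smul_of_retract hrs (g (r' (Pi.single j 1)))]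
    simp
  simp only [retractTrace, LinearMap.comp_apply, h1, h2]
  rw [Finset.sum_comm]
  simp only [h.comm]

theorem retractTrace_comp_self (h : IsSymmetrizingForm lam) (hrs : r ∘ₗ s = LinearMap.id)
    (f : P →ₗ[R] R) (g : R →ₗ[R] P) :
    retractTrace lam r s (g ∘ₗ f) = lam (f (g 1)) := by
  have h1 : ∀ i, lam (s (g (f (r (Pi.single i 1)))) i) =
      lam (s (g 1) i * f (r (Pi.single i 1))) := fun i ↦ by
    rw [← mul_one (f (r (Pi.single i 1))), ← smul_eq_mul, map_smul, map_smul, Pi.smul_apply,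
      smul_eq_mul, h.comm, smul_eq_mul, mul_one]
  simp only [retractTrace, LinearMap.comp_apply, h1]
  conv_rhs => rw [eq_sum_smul_of_retract hrs (g 1)]
  simp

variable {N : Type*} [AddCommGroup N] [Module R N]

theorem exists_retractTrace_ne_zero_right (h : IsSymmetrizingForm lam)
    (hrs : r ∘ₗ s = LinearMap.id) (g : N →ₗ[R] P) (hg : g ≠ 0) :
    ∃ f : P →ₗ[R] N, retractTrace lam r s (g ∘ₗ f) ≠ 0 := by
  obtain ⟨x, hx⟩ : ∃ x, g x ≠ 0 := by
    by_contra! h0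
    exact hg (LinearMap.ext h0)
  obtain ⟨i, hi⟩ : ∃ i, s (g x) i ≠ 0 := by
    by_contra! h0
    apply hx
    rw [eq_sum_smul_of_retract hrs (g x)]
    simp [h0]
  obtain ⟨c, hc⟩ := h.nondegenerate _ hi
  -- This map factors through `R`, so the trace collapses to `lam` of a single product.
  refine ⟨LinearMap.toSpanSingleton R N (c • x) ∘ₗ LinearMap.proj i ∘ₗ s, ?_⟩
  rw [← LinearMap.comp_assoc, retractTrace_comp_self h hrs]
  simpa [h.comm c] using hc

theorem exists_retractTrace_ne_zero_left [Module.Finite K R] (h : IsSymmetrizingForm lam)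
    (hrs : r ∘ₗ s = LinearMap.id) (f : P →ₗ[R] N) (hf : f ≠ 0) :
    ∃ g : N →ₗ[R] P, retractTrace lam r s (g ∘ₗ f) ≠ 0 := by
  let : Module K N := Module.compHom N (algebraMap K R)
  have : IsScalarTower K R N := IsScalarTower.of_algebraMap_smul fun _ _ ↦ rfl
  obtain ⟨i, hi⟩ : ∃ i, f (r (Pi.single i 1)) ≠ 0 := by
    by_contra! h0
    apply hf
    ext p
    rw [eq_sum_smul_of_retract hrs p]
    simp [h0]
  obtain ⟨xi, hxi⟩ : ∃ xi : Module.Dual K N, xi (f (r (Pi.single i 1))) ≠ 0 := by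
    by_contra! h0
    exact hi ((Module.forall_dual_apply_eq_zero_iff K _).1 h0)
  obtain ⟨g, hg⟩ := h.exists_lift xi
  refine ⟨LinearMap.toSpanSingleton R P (r (Pi.single i 1)) ∘ₗ g, ?_⟩
  rw [LinearMap.comp_assoc, retractTrace_comp_self h hrs]
  simpa [hg] using hxi

variable (lam r s N) in
/-- The pairing `(g, f) ↦ tr (g ∘ f)` between `Hom(N, P)` and `Hom(P, N)`. -/
def retractPairing [Module K N] [IsScalarTower K R N] [Module K P] [IsScalarTower K R P] :
    (N →ₗ[R] P) →ₗ[K] (P →ₗ[R] N) →ₗ[K] K :=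
  LinearMap.mk₂ K (fun g f ↦ retractTrace lam r s (g ∘ₗ f))
    (fun g g' f ↦ by simp [retractTrace, Finset.sum_add_distrib])
    (fun c g f ↦ by
      simp only [retractTrace, LinearMap.comp_apply, LinearMap.smul_apply, Finset.smul_sum]
      refine Finset.sum_congr rfl fun i _ ↦ ?_
      rw [LinearMap.map_smul_of_tower, Pi.smul_apply, map_smul])
    (fun g f f' ↦ by simp [retractTrace, Finset.sum_add_distrib])
    (fun c g f ↦ by
      simp only [retractTrace, LinearMap.comp_apply, LinearMap.smul_apply, Finset.smul_sum]
      refine Finset.sum_congr rfl fun i _ ↦ ?_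
      rw [LinearMap.map_smul_of_tower, LinearMap.map_smul_of_tower, Pi.smul_apply, map_smul])

end Trace

/-- The trace pairing makes `Hom(N, P•)` dual to `Hom(P•, N)`, so exactness of the latter at `P₁`
passes to the former. -/
theorem IsSymmetrizingForm.exists_comp_eq_of_exact
    {K R : Type*} [Field K] [Ring R] [Algebra K R] [Module.Finite K R]
    {lam : R →ₗ[K] K} (h : IsSymmetrizingForm lam)
    {P₀ P₁ P₂ N : Type*} [AddCommGroup P₀] [Module R P₀] [AddCommGroup P₁] [Module R P₁]
    [AddCommGroup P₂] [Module R P₂] [AddCommGroup N] [Module R N]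
    [Module.Finite R P₀] [Module.Projective R P₀] [Module.Finite R P₁] [Module.Projective R P₁]
    [Module.Finite R P₂] [Module.Projective R P₂] [Module.Finite R N]
    (d₂ : P₂ →ₗ[R] P₁) (d₁ : P₁ →ₗ[R] P₀)
    (hN : ∀ f : P₁ →ₗ[R] N, f ∘ₗ d₂ = 0 → ∃ f' : P₀ →ₗ[R] N, f' ∘ₗ d₁ = f)
    (g : N →ₗ[R] P₁) (hg : d₁ ∘ₗ g = 0) :
    ∃ g' : N →ₗ[R] P₂, d₂ ∘ₗ g' = g := by
  obtain ⟨n₀, r₀, s₀, -, -, hrs₀⟩ := Module.Finite.exists_comp_eq_id_of_projective R P₀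
  obtain ⟨n₁, r₁, s₁, -, -, hrs₁⟩ := Module.Finite.exists_comp_eq_id_of_projective R P₁
  obtain ⟨n₂, r₂, s₂, -, -, hrs₂⟩ := Module.Finite.exists_comp_eq_id_of_projective R P₂
  let : Module K N := Module.compHom N (algebraMap K R)
  let : Module K P₁ := Module.compHom P₁ (algebraMap K R)
  let : Module K P₂ := Module.compHom P₂ (algebraMap K R)
  have : IsScalarTower K R N := IsScalarTower.of_algebraMap_smul fun _ _ ↦ rfl
  have : IsScalarTower K R P₁ := IsScalarTower.of_algebraMap_smul fun _ _ ↦ rfl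
  have : IsScalarTower K R P₂ := IsScalarTower.of_algebraMap_smul fun _ _ ↦ rfl
  have : Module.Finite K N := Module.Finite.trans R N
  have : Module.Finite K P₁ := Module.Finite.trans R P₁
  have : Module.Finite K (N →ₗ[R] P₁) :=
    Module.Finite.of_injective (LinearMap.restrictScalarsₗ K R N P₁ K)
      (LinearMap.restrictScalars_injective K)
  have hinj : Function.Injective (retractPairing lam r₁ s₁ N) := by
    rw [injective_iff_map_eq_zero]
    intro g hg
    by_contra hne
    obtain ⟨f, hf⟩ := exists_retractTrace_ne_zero_right h hrs₁ g hne
    exact hf (LinearMap.congr_fun hg f)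
  have hsurj := LinearMap.flip_surjective_iff₁.2 hinj
  let W : Submodule K (N →ₗ[R] P₁) := LinearMap.range
    ({ toFun g' := d₂ ∘ₗ g'
       map_add' := fun _ _ ↦ LinearMap.comp_add _ _ _
       map_smul' := fun c g' ↦ by ext x; exact LinearMap.map_smul_of_tower d₂ c (g' x) } :
      (N →ₗ[R] P₂) →ₗ[K] (N →ₗ[R] P₁))
  by_contra hno
  -- A functional vanishing on `W` but not at `g` has the form `tr (- ∘ f)`, as `Hom(N, P₁)` is
  -- finite-dimensional. Vanishing on `W` gives `f ∘ d₂ = 0`, so `f` factors through `d₁`, and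
  -- cyclicity of the trace then kills it at `g`.
  have hgW : g ∉ W := fun ⟨g', hg'⟩ ↦ hno ⟨g', hg'⟩
  obtain ⟨φ, hφg, hφ⟩ := Submodule.exists_le_ker_of_notMem hgW
  obtain ⟨f, rfl⟩ := hsurj φ
  have hf : f ∘ₗ d₂ = 0 := by
    by_contra hne
    obtain ⟨g', hg'⟩ := exists_retractTrace_ne_zero_left h hrs₂ _ hne
    apply hg'
    rw [← LinearMap.comp_assoc, retractTrace_comm h hrs₂ hrs₁ d₂ (g' ∘ₗ f), ← LinearMap.comp_assoc]
    exact hφ (show d₂ ∘ₗ g' ∈ W from ⟨g', rfl⟩)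
  obtain ⟨f', rfl⟩ := hN f hf
  apply hφg
  change retractTrace lam r₁ s₁ (g ∘ₗ f' ∘ₗ d₁) = 0
  rw [← LinearMap.comp_assoc, retractTrace_comm h hrs₁ hrs₀ d₁ (g ∘ₗ f'), ← LinearMap.comp_assoc,
    hg]
  simp [retractTrace]

universe w

/-! ### Vanishing of Ext along short exact sequences. -/

section ExtOfShortExact

open CategoryTheory Abelian

variable {C : Type*} [Category* C] [Abelian C] [HasExt.{w} C]
  {S : ShortComplex C}

theorem CategoryTheory.ShortComplex.ShortExact.subsingleton_ext_iff (hS : S.ShortExact)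
    [Projective S.X₂] (N : C) (n : ℕ) :
    Subsingleton (Ext S.X₃ N (n + 2)) ↔ Subsingleton (Ext S.X₁ N (n + 1)) := by
  constructor
  · intro h
    refine subsingleton_of_forall_eq 0 fun x ↦ ?_
    obtain ⟨y, hy⟩ := Ext.contravariant_sequence_exact₁ hS N x (n₁ := n + 2) (by lia)
      (Subsingleton.elim _ _)
    rw [← hy, Ext.eq_zero_of_projective y, Ext.comp_zero]
  · intro h
    refine subsingleton_of_forall_eq 0 fun x ↦ ?_
    obtain ⟨y, hy⟩ := Ext.contravariant_sequence_exact₃ hS N x (Ext.eq_zero_of_projective _)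
      (n₀ := n + 1) (by lia)
    rw [← hy, Subsingleton.elim y 0, Ext.comp_zero]

theorem CategoryTheory.ShortComplex.ShortExact.exists_comp_eq_of_subsingleton_ext_one
    (hS : S.ShortExact) {N : C} [Subsingleton (Ext S.X₃ N 1)] (f : S.X₁ ⟶ N) :
    ∃ f' : S.X₂ ⟶ N, S.f ≫ f' = f := by
  obtain ⟨y, hy⟩ := Ext.contravariant_sequence_exact₁ hS N (Ext.mk₀ f) (n₁ := 1) (by lia)
    (Subsingleton.elim _ _)
  obtain ⟨f', rfl⟩ := (Ext.mk₀_bijective _ _).2 y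
  rw [Ext.mk₀_comp_mk₀] at hy
  exact ⟨f', (Ext.mk₀_bijective _ _).1 hy⟩

theorem CategoryTheory.ShortComplex.ShortExact.subsingleton_ext_one_of_forall_exists_comp_eq
    (hS : S.ShortExact) [Projective S.X₂] {N : C}
    (h : ∀ f : S.X₁ ⟶ N, ∃ f' : S.X₂ ⟶ N, S.f ≫ f' = f) : Subsingleton (Ext S.X₃ N 1) := by
  refine subsingleton_of_forall_eq 0 fun x ↦ ?_
  obtain ⟨y, hy⟩ := Ext.contravariant_sequence_exact₃ hS N x (Ext.eq_zero_of_projective _)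
    (n₀ := 0) (by lia)
  obtain ⟨f, rfl⟩ := (Ext.mk₀_bijective _ _).2 y
  obtain ⟨f', rfl⟩ := h f
  rw [← hy, ← Ext.mk₀_comp_mk₀, ← Ext.comp_assoc_of_second_deg_zero, hS.extClass_comp,
    Ext.zero_comp]

theorem CategoryTheory.ShortComplex.ShortExact.subsingleton_ext_one_of_forall_exists_lift
    (hS : S.ShortExact) {N : C} [Subsingleton (Ext N S.X₂ 1)]
    (h : ∀ f : N ⟶ S.X₃, ∃ f' : N ⟶ S.X₂, f' ≫ S.g = f) : Subsingleton (Ext N S.X₁ 1) := by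
  refine subsingleton_of_forall_eq 0 fun x ↦ ?_
  obtain ⟨y, hy⟩ := Ext.covariant_sequence_exact₁ N hS x (Subsingleton.elim _ _)
    (n₀ := 0) (by lia)
  obtain ⟨f, rfl⟩ := (Ext.mk₀_bijective _ _).2 y
  obtain ⟨f', rfl⟩ := h f
  rw [← hy, ← Ext.mk₀_comp_mk₀, Ext.comp_assoc_of_second_deg_zero, hS.comp_extClass,
    Ext.comp_zero]

theorem CategoryTheory.Iso.subsingleton_ext_left_iff {X Y : C} (e : X ≅ Y) (N : C) (n : ℕ) :
    Subsingleton (Ext X N n) ↔ Subsingleton (Ext Y N n) := by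
  have key : ∀ {X Y : C} (e : X ≅ Y), Subsingleton (Ext X N n) → Subsingleton (Ext Y N n) :=
    fun {X Y} e h ↦ subsingleton_of_forall_eq 0 fun x ↦ by
      have : (Ext.mk₀ e.inv).comp ((Ext.mk₀ e.hom).comp x (zero_add n)) (zero_add n) = x := by
        simp
      rw [← this, Subsingleton.elim ((Ext.mk₀ e.hom).comp x (zero_add n)) 0, Ext.comp_zero]
  exact ⟨key e, key e.symm⟩

theorem CategoryTheory.Iso.subsingleton_ext_right {X Y : C} (e : X ≅ Y) (N : C) (n : ℕ)
    [Subsingleton (Ext N X n)] : Subsingleton (Ext N Y n) :=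
  subsingleton_of_forall_eq 0 fun x ↦ by
    have : (x.comp (Ext.mk₀ e.inv) (add_zero n)).comp (Ext.mk₀ e.hom) (add_zero n) = x := by
      simp
    rw [← this, Subsingleton.elim (x.comp (Ext.mk₀ e.inv) (add_zero n)) 0, Ext.zero_comp]

end ExtOfShortExact

/-! ### Syzygies and the periodicity argument. -/

section Syzygy

open CategoryTheory Abelian

variable {R : Type v} [Ring R]

/-- The short complex `0 → ker f → P → X → 0` attached to a linear map `f : P → X`. -/
abbrev kerShortComplex {P X : ModuleCat.{v} R} (f : P →ₗ[R] X) : ShortComplex (ModuleCat.{v} R) :=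
  ShortComplex.mk (X₁ := ModuleCat.of R (LinearMap.ker f))
    (ModuleCat.ofHom (LinearMap.ker f).subtype) (ModuleCat.ofHom f) (by
      ext x
      exact x.2)

theorem kerShortComplex_shortExact {P X : ModuleCat.{v} R} (f : P →ₗ[R] X)
    (hf : Function.Surjective f) : (kerShortComplex f).ShortExact where
  exact := (ShortComplex.ShortExact.moduleCat_exact_iff_function_exact _).2 fun x ↦
    ⟨fun hx ↦ ⟨⟨x, hx⟩, rfl⟩, by rintro ⟨y, rfl⟩; exact y.2⟩
  mono_f := (ModuleCat.mono_iff_injective _).2 Subtype.val_injective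
  epi_g := (ModuleCat.epi_iff_surjective _).2 hf

/-- Lifts of generators of `M` span `P` modulo the kernel, hence span `P`. Only here does
superfluity of the kernel enter. -/
theorem IsProjectiveCover.finite {P M : Type v} [AddCommGroup P] [Module R P]
    [AddCommGroup M] [Module R M] {f : P →ₗ[R] M} (hf : IsProjectiveCover f) [Module.Finite R M] :
    Module.Finite R P := by
  obtain ⟨n, s, hs⟩ := Module.Finite.exists_fin (R := R) (M := M)
  choose t ht using fun i ↦ hf.surjective (s i)
  have hU : (Submodule.span R (Set.range t)).map f = ⊤ := by
    rw [Submodule.map_span, ← Set.range_comp, ← hs]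
    congr 2
    exact funext ht
  refine ⟨hf.superfluous (Submodule.span R (Set.range t)) ?_ ▸
    Submodule.fg_span (Set.finite_range t)⟩
  rw [sup_comm, ← Submodule.comap_map_eq, hU, Submodule.comap_top]

theorem LinearMap.exists_comp_eq_of_surjective {P X N : Type*} [AddCommGroup P] [Module R P]
    [AddCommGroup X] [Module R X] [AddCommGroup N] [Module R N] (p : P →ₗ[R] X)
    (hp : Function.Surjective p) (f : P →ₗ[R] N) (hf : ∀ x, p x = 0 → f x = 0) :
    ∃ f' : X →ₗ[R] N, f' ∘ₗ p = f := by
  refine ⟨(LinearMap.ker p).liftQ f hf ∘ₗ (p.quotKerEquivOfSurjective hp).symm.toLinearMap, ?_⟩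
  ext x
  have : (p.quotKerEquivOfSurjective hp).symm (p x) = Submodule.Quotient.mk x := by
    rw [LinearEquiv.symm_apply_eq]
    rfl
  rw [LinearMap.comp_apply, LinearMap.comp_apply, LinearEquiv.coe_coe, this]
  exact Submodule.liftQ_apply _ _ _

theorem exists_extend_of_subsingleton_ext_one {P X : ModuleCat.{v} R} (f : P →ₗ[R] X)
    (hf : Function.Surjective f) (N : ModuleCat.{v} R) (h : Subsingleton (Ext X N 1))
    (g : LinearMap.ker f →ₗ[R] N) : ∃ g' : P →ₗ[R] N, g' ∘ₗ (LinearMap.ker f).subtype = g := by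
  have : Subsingleton (Ext (kerShortComplex f).X₃ N 1) := h
  obtain ⟨g', hg'⟩ := (kerShortComplex_shortExact f hf).exists_comp_eq_of_subsingleton_ext_one
    (N := N) (ModuleCat.ofHom g)
  exact ⟨g'.hom, congr_arg ModuleCat.Hom.hom hg'⟩

variable {K : Type*} [Field K] [Algebra K R] [Module.Finite K R] {lam : R →ₗ[K] K}

theorem IsSymmetrizingForm.exists_lift_of_subsingleton_ext_one (hlam : IsSymmetrizingForm lam)
    {X P₀ P₁ P₂ N : ModuleCat.{v} R}
    [Module.Finite R P₀] [Module.Projective R P₀] [Module.Finite R P₁] [Module.Projective R P₁]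
    [Module.Finite R P₂] [Module.Projective R P₂] [Module.Finite R N]
    (f₀ : P₀ →ₗ[R] X) (f₁ : P₁ →ₗ[R] LinearMap.ker f₀) (f₂ : P₂ →ₗ[R] LinearMap.ker f₁)
    (h₀ : Function.Surjective f₀) (h₁ : Function.Surjective f₁) (h₂ : Function.Surjective f₂)
    (h : Subsingleton (Ext X N 1)) (g : N →ₗ[R] LinearMap.ker f₁) :
    ∃ g' : N →ₗ[R] P₂, f₂ ∘ₗ g' = g := by
  obtain ⟨g', hg'⟩ := hlam.exists_comp_eq_of_exact (N := N)
    ((LinearMap.ker f₁).subtype ∘ₗ f₂) ((LinearMap.ker f₀).subtype ∘ₗ f₁)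
    -- A map killing the image of `P₂`, which is `ker f₁`, descends to `ker f₀` and extends to `P₀`
    -- since `Ext¹(X, N) = 0`.
    (fun f hf ↦ by
      obtain ⟨f', rfl⟩ := f₁.exists_comp_eq_of_surjective h₁ f fun x hx ↦ by
        obtain ⟨y, hy⟩ := h₂ ⟨x, hx⟩
        simpa [hy] using LinearMap.congr_fun hf y
      obtain ⟨f'', rfl⟩ := exists_extend_of_subsingleton_ext_one f₀ h₀ N h f'
      exact ⟨f'', rfl⟩)
    ((LinearMap.ker f₁).subtype ∘ₗ g) (by
      ext x
      simp)
  exact ⟨g', LinearMap.ext fun x ↦ Subtype.ext (LinearMap.congr_fun hg' x)⟩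

theorem subsingleton_ext_add_two_iff {P X : ModuleCat.{v} R} [Module.Projective R P]
    (f : P →ₗ[R] X) (hf : Function.Surjective f) (N : ModuleCat.{v} R) (n : ℕ) :
    Subsingleton (Ext X N (n + 2)) ↔
      Subsingleton (Ext (ModuleCat.of R (LinearMap.ker f)) N (n + 1)) := by
  have : Projective (kerShortComplex f).X₂ := P.projective_of_categoryTheory_projective
  exact (kerShortComplex_shortExact f hf).subsingleton_ext_iff N n

theorem IsSymmetrizingForm.subsingleton_ext_one (hlam : IsSymmetrizingForm lam)
    {P X Q : ModuleCat.{v} R} [Module.Projective R P] (f : P →ₗ[R] X)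
    (hf : Function.Surjective f) [Module.Finite R Q] [Module.Projective R Q] :
    Subsingleton (Ext X Q 1) := by
  have : Projective (kerShortComplex f).X₂ := P.projective_of_categoryTheory_projective
  refine (kerShortComplex_shortExact f hf).subsingleton_ext_one_of_forall_exists_comp_eq
    fun g ↦ ?_
  obtain ⟨g', hg'⟩ := hlam.exists_extend (LinearMap.ker f).subtype Subtype.val_injective g.hom
  exact ⟨ModuleCat.ofHom g', ModuleCat.hom_ext hg'⟩

/-- Over a symmetric algebra, a module of `Ω`-period four with a nonzero self-extension has
nonzero self-extensions in all positive degrees. -/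
theorem IsSymmetrizingForm.nontrivial_ext_self (hlam : IsSymmetrizingForm lam)
    (M : ModuleCat.{v} R) [Module.Finite R M] (hM : IsSyzygy R 4 M M)
    (h1 : Nontrivial (Ext M M 1)) (i : ℕ) (hi : 1 ≤ i) : Nontrivial (Ext M M i) := by
  -- Keeps the successive kernels finitely generated, hence also their covers.
  have : IsNoetherianRing R := IsNoetherianRing.of_finite K R
  obtain ⟨P₀, f₀, hf₀, P₁, f₁, hf₁, P₂, f₂, hf₂, P₃, f₃, hf₃, ⟨e⟩⟩ := hM
  have := hf₀.projective
  have := hf₁.projective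
  have := hf₂.projective
  have := hf₃.projective
  have : Module.Finite R P₀ := hf₀.finite
  have : Module.Finite R P₁ := hf₁.finite
  have : Module.Finite R P₂ := hf₂.finite
  have : Module.Finite R P₃ := hf₃.finite
  have hproj : ¬ Module.Projective R M := fun _ ↦ by
    have : Projective M := M.projective_of_categoryTheory_projective
    exact not_subsingleton _ (Ext.subsingleton_of_projective M M 0)
  let e' : LinearMap.ker f₃ ≃ₗ[R] M := e.toLinearEquiv
  have s₁ := fun n ↦ subsingleton_ext_add_two_iff f₀ hf₀.surjective M n
  have s₂ := fun n ↦ subsingleton_ext_add_two_iff (X := ModuleCat.of R (LinearMap.ker f₀))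
    f₁ hf₁.surjective M n
  have s₃ := fun n ↦ subsingleton_ext_add_two_iff (X := ModuleCat.of R (LinearMap.ker f₁))
    f₂ hf₂.surjective M n
  have s₄ := fun n ↦ subsingleton_ext_add_two_iff (X := ModuleCat.of R (LinearMap.ker f₂))
    f₃ hf₃.surjective M n
  have ext_two : ¬ Subsingleton (Ext M M 2) := fun h ↦ by
    have lift := hlam.exists_lift_of_subsingleton_ext_one
      (X := ModuleCat.of R (LinearMap.ker f₀)) f₁ f₂ f₃ hf₁.surjective hf₂.surjective
      hf₃.surjective ((s₁ 0).1 h)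
    -- `P₃` is injective relative to all modules, so only the lifting of maps `M → Ω³M` obstructs
    -- `Ext¹(M, Ω⁴M) = 0`.
    have : Subsingleton (Ext M (kerShortComplex (X := ModuleCat.of R (LinearMap.ker f₂)) f₃).X₂ 1) :=
      hlam.subsingleton_ext_one f₀ hf₀.surjective
    have := (kerShortComplex_shortExact (X := ModuleCat.of R (LinearMap.ker f₂)) f₃
      hf₃.surjective).subsingleton_ext_one_of_forall_exists_lift (N := M) fun g ↦ by
        obtain ⟨g', hg'⟩ := lift g.hom
        exact ⟨ModuleCat.ofHom g', ModuleCat.hom_ext hg'⟩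
    exact not_subsingleton _ (e.subsingleton_ext_right M 1)
  have ext_three : ¬ Subsingleton (Ext M M 3) := fun h ↦ by
    -- By periodicity `P₀ → M ≅ Ω⁴M` continues the resolution; lifting `M ≅ Ω⁴M` through it splits
    -- `f₀`.
    obtain ⟨g, hg⟩ := hlam.exists_lift_of_subsingleton_ext_one
      (X := ModuleCat.of R (LinearMap.ker f₁)) f₂ f₃ (e'.symm.toLinearMap ∘ₗ f₀)
      hf₂.surjective hf₃.surjective (e'.symm.surjective.comp hf₀.surjective)
      ((s₂ 0).1 ((s₁ 1).1 h)) e'.symm.toLinearMap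
    refine hproj (Module.Projective.of_split g f₀ (LinearMap.ext fun x ↦ ?_))
    exact e'.symm.injective (LinearMap.congr_fun hg x)
  have ext_four : ¬ Subsingleton (Ext M M 4) := fun h ↦ by
    -- Extending `Ω⁴M ≅ M` to `P₃` makes `M` a direct summand of `P₃`.
    obtain ⟨g, hg⟩ := exists_extend_of_subsingleton_ext_one
      (X := ModuleCat.of R (LinearMap.ker f₂)) f₃ hf₃.surjective M
      ((s₃ 0).1 ((s₂ 1).1 ((s₁ 2).1 h))) e'.toLinearMap
    refine hproj (Module.Projective.of_split
      ((LinearMap.ker f₃).subtype ∘ₗ e'.symm.toLinearMap) g (LinearMap.ext fun x ↦ ?_))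
    exact (LinearMap.congr_fun hg (e'.symm x)).trans (e'.apply_symm_apply x)
  suffices ∀ n, ¬ Subsingleton (Ext M M (n + 1)) by
    obtain ⟨n, rfl⟩ := Nat.exists_eq_add_of_le' hi
    exact not_subsingleton_iff_nontrivial.1 (this n)
  intro n
  induction n using Nat.strong_induction_on with
  | h n ih =>
    match n with
    | 0 => exact not_subsingleton_iff_nontrivial.2 h1
    | 1 => exact ext_two
    | 2 => exact ext_three
    | 3 => exact ext_four
    | n + 4 =>
      -- Four dimension shifts take `Ext` degree `n + 5` of `M` to degree `n + 1` of `Ω⁴M ≅ M`.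
      rw [s₁, s₂, s₃, s₄, e.subsingleton_ext_left_iff]
      exact ih n (by lia)

end Syzygy

/-- Right `A`-modules are the modules over the opposite ring `Aᵐᵒᵖ`. -/
theorem proposition2p6 {K : Type u} {A : Type v} [Field K] [Ring A] [Algebra K A]
    (hA : IsSymmetricAlg K A)
    (M : ModuleCat.{v} Aᵐᵒᵖ) [Module.Finite Aᵐᵒᵖ M]
    (hM : IsSyzygy Aᵐᵒᵖ 4 M M)
    (h1 : Nontrivial (CategoryTheory.Abelian.Ext M M 1)) :
    ∀ i : ℕ, 1 ≤ i → Nontrivial (CategoryTheory.Abelian.Ext M M i) := by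
  have := hA.finite
  obtain ⟨lam, hlam⟩ := hA.exists_isSymmetrizingForm_op
  exact hlam.nontrivial_ext_self M hM h1
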